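/- Let $\mathcal X$ be a uniformly convex, smooth, complex Banach space of analytic functions on a domain (nonempty connected open set) $\Omega\subset\mathbb C$ with $0\in\Omega$. (Smooth: every $x\neq 0$ has exactly one $\ell\in\mathcal X^*$ with $\|\ell\|=1$ and $\ell(x)=\|x\|$.) For $f,g\in\mathcal X$ write $f\perp_{\mathcal X} g$ (Birkhoff–James orthogonality) if $\|f+\beta g\|\ge\|f\|$ for all $\beta\in\mathbb C$. Assume: (X1) for every $j\ge 0$ and $w\in\Omega$ there is a constant $C$ with $|f^{(j)}(w)|\le C\|f\|$ for all $f\in\mathcal X$; (X2) $f\in\mathcal X$ implies $zf\in\mathcal X$; (X3) the monomials $z^j$, $j\ge 0$, belong to $\mathcal X$ and their closed linear span is $\mathcal X$; (X4) for $w\in\Omega$ and $f\in\mathcal X$, the function $z\mapsto \frac{f(z)-f(w)}{z-w}$ (with value $f'(w)$ at $w$) belongs to $\mathcal X$; (X5) there are constants $r,K>0$ such that $f\perp_{\mathcal X} g$ implies $\|f+g\|^r\ge\|f\|^r+K\|g\|^r$. Let $S_{\mathcal X}:\mathcal X\to\mathcal X$, $(S_{\mathcal X}f)(z)=zf(z)$,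 which is a bounded operator. Call $f\in\mathcal X\setminus\{0\}$ $S_{\mathcal X}$-inner if $f\perp_{\mathcal X}S_{\mathcal X}^n f$ for all $n\ge 1$. For $f\in\mathcal X$ let $[zf]$ be the closed linear span of $\{z^jf: j\ge 1\}$, and let $P_{[zf]}f$ be the metric projection of $f$ onto $[zf]$, that is, the unique point of $[zf]$ nearest to $f$. Let $(w_j)_{j\ge 1}$ be a sequence in $\Omega\setminus\{0\}$ (repetitions allowed), and for $n\ge 0$ (the empty product being $1$) put $$f_n(z)=\prod_{j=1}^n\Bigl(1-\frac{z}{w_j}\Bigr),\qquad J_n=f_n-P_{[zf_n]}f_n .$$ Then: 1. each $J_n$ is an $S_{\mathcal X}$-inner function; 2. the sequence $\|J_n\|$ is non-decreasing; 3. $(w_j)_{j\ge1}$ is a zero sequence for $\mathcal X$ if and only if $\sup_n\|J_n\|<\infty$. Here $(w_j)_{j\ge 1}$ is a zero sequence for $\mathcal X$ if there is $g\in\mathcal X\setminus\{0\}$ that vanishes at each $w_j$ to order at least the number of times the value $w_j$ occurs in the sequence (to every order if it occurs infinitely often); $g$ may have further zeros. -/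

import Mathlib

open Filter Topology

/-! ### Geometry of Banach spaces -/

/-- A complex normed space is smooth when every nonzero vector has exactly one norming functional. -/
def IsSmoothSpace (X : Type*) [NormedAddCommGroup X] [NormedSpace ℂ X] : Prop :=
  ∀ x : X, x ≠ 0 → ∃! l : X →L[ℂ] ℂ, ‖l‖ = 1 ∧ l x = (‖x‖ : ℂ)

/-- Birkhoff–James orthogonality `x ⊥ y`. -/
def BJOrthogonal {X : Type*} [NormedAddCommGroup X] [NormedSpace ℂ X] (x y : X) : Prop :=
  ∀ β : ℂ, ‖x‖ ≤ ‖x + β • y‖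

/-- The Pythagorean inequality for Birkhoff–James orthogonality, with some constants `r, K > 0`. -/
def PythagoreanInequality (X : Type*) [NormedAddCommGroup X] [NormedSpace ℂ X] : Prop :=
  ∃ r K : ℝ, 0 < r ∧ 0 < K ∧
    ∀ f g : X, BJOrthogonal f g → ‖f‖ ^ r + K * ‖g‖ ^ r ≤ ‖f + g‖ ^ r

/-- `x` is `T`-inner: it is nonzero and orthogonal to `T ^ n x` for all `n ≥ 1`. -/
def IsInnerVector {X : Type*} [NormedAddCommGroup X] [NormedSpace ℂ X]
    (T : X →L[ℂ] X) (x : X) : Prop :=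
  x ≠ 0 ∧ ∀ n : ℕ, 1 ≤ n → BJOrthogonal x ((T ^ n) x)

/-- `[x]`: the closed linear span of the orbit `x, T x, T² x, …`. -/
def cyclicSubspace {X : Type*} [NormedAddCommGroup X] [NormedSpace ℂ X]
    (T : X →L[ℂ] X) (x : X) : Submodule ℂ X :=
  (Submodule.span ℂ (Set.range fun n : ℕ => (T ^ n) x)).topologicalClosure

theorem isClosed_cyclicSubspace {X : Type*} [NormedAddCommGroup X] [NormedSpace ℂ X]
    (T : X →L[ℂ] X) (x : X) : IsClosed (cyclicSubspace T x : Set X) :=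
  Submodule.isClosed_topologicalClosure _

/-- `y` is a nearest point of the subspace `Y` to `x`. -/
def IsNearestPoint {X : Type*} [NormedAddCommGroup X] [NormedSpace ℂ X]
    (Y : Submodule ℂ X) (x y : X) : Prop :=
  y ∈ Y ∧ ∀ y' ∈ Y, ‖x - y‖ ≤ ‖x - y'‖

/-- Almost minimal elements of a subspace are close to each other. -/
theorem dist_lt_of_almost_nearest {X : Type*} [NormedAddCommGroup X] [NormedSpace ℂ X]
    [UniformConvexSpace X] (Y : Submodule ℂ X) (x : X) (d : ℝ) (hd : 0 ≤ d)
    (hmin : ∀ y ∈ Y, d ≤ ‖x - y‖) {ε : ℝ} (hε : 0 < ε) :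
    ∃ η : ℝ, 0 < η ∧ ∀ y ∈ Y, ∀ y' ∈ Y, ‖x - y‖ ≤ d + η → ‖x - y'‖ ≤ d + η →
      ‖y - y'‖ < ε := by
  letI : NormedSpace ℝ X := NormedSpace.restrictScalars ℝ ℂ X
  obtain ⟨δ, hδ, H⟩ := exists_forall_closed_ball_dist_add_le_two_mul_sub X (half_pos hε) d
  obtain ⟨η, hη, h1, h2⟩ : ∃ η : ℝ, 0 < η ∧ 4 * η ≤ ε ∧ 4 * η ≤ δ :=
    ⟨min ε δ / 4, by positivity, by linarith [min_le_left ε δ], by linarith [min_le_right ε δ]⟩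
  refine ⟨η, hη, fun y hy y' hy' hn hn' => ?_⟩
  by_contra hcon
  push Not at hcon
  have hpos : 0 < d + η := by linarith
  have key : ∀ a : X, ‖a‖ ≤ d + η →
      ‖(d / (d + η)) • a‖ ≤ d ∧ ‖a - (d / (d + η)) • a‖ ≤ η := by
    intro a ha
    have hc : 0 ≤ d / (d + η) := by positivity
    have hc1 : 0 ≤ 1 - d / (d + η) := by
      rw [sub_nonneg, div_le_one hpos]; linarith
    constructor
    · rw [norm_smul, Real.norm_of_nonneg hc]
      calc d / (d + η) * ‖a‖ ≤ d / (d + η) * (d + η) := by gcongr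
        _ = d := by field_simp
    · have : a - (d / (d + η)) • a = (1 - d / (d + η)) • a := by rw [sub_smul, one_smul]
      rw [this, norm_smul, Real.norm_of_nonneg hc1]
      calc (1 - d / (d + η)) * ‖a‖ ≤ (1 - d / (d + η)) * (d + η) := by gcongr
        _ = η := by field_simp; ring
  obtain ⟨ha, ha'⟩ := key _ hn
  obtain ⟨hb, hb'⟩ := key _ hn'
  set a := x - y with haa
  set b := x - y' with hbb
  set a' := (d / (d + η)) • a
  set b' := (d / (d + η)) • b
  have hab : ε ≤ ‖a - b‖ := by
    have : a - b = -(y - y') := by rw [haa, hbb]; abel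
    rw [this, norm_neg]; exact hcon
  have t1 : ‖a - b‖ ≤ ‖a' - b'‖ + η + η := by
    have : a - b = (a' - b') + (a - a') + -(b - b') := by abel
    rw [this]
    refine (norm_add₃_le).trans ?_
    rw [norm_neg]; linarith
  have t2 : ‖a + b‖ ≤ ‖a' + b'‖ + η + η := by
    have : a + b = (a' + b') + (a - a') + (b - b') := by abel
    rw [this]
    refine (norm_add₃_le).trans ?_
    linarith
  have t3 := H ha hb (by linarith)
  have t4 : 2 * d ≤ ‖a + b‖ := by
    have hm := hmin ((2 : ℂ)⁻¹ • (y + y')) (Y.smul_mem _ (Y.add_mem hy hy'))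
    have e : a + b = (2 : ℂ) • (x - (2 : ℂ)⁻¹ • (y + y')) := by
      rw [smul_sub, smul_smul, mul_inv_cancel₀ two_ne_zero, one_smul, two_smul, haa, hbb]; abel
    rw [e, norm_smul, Complex.norm_ofNat]
    linarith
  linarith

/-- In a uniformly convex Banach space a closed subspace has unique nearest points. -/
theorem existsUnique_isNearestPoint {X : Type*} [NormedAddCommGroup X] [NormedSpace ℂ X]
    [CompleteSpace X] [UniformConvexSpace X] (Y : Submodule ℂ X) (hY : IsClosed (Y : Set X))
    (x : X) : ∃! y : X, IsNearestPoint Y x y := by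
  have hne : (Y : Set X).Nonempty := ⟨0, Y.zero_mem⟩
  set d := Metric.infDist x (Y : Set X) with hd
  have hd0 : 0 ≤ d := Metric.infDist_nonneg
  have hmin : ∀ y ∈ Y, d ≤ ‖x - y‖ := fun y hy => by
    rw [← dist_eq_norm]; exact Metric.infDist_le_dist_of_mem hy
  have hseq : ∀ n : ℕ, ∃ y ∈ Y, ‖x - y‖ < d + 1 / ((n : ℝ) + 1) := fun n => by
    obtain ⟨y, hy, h⟩ := (Metric.infDist_lt_iff (x := x) hne).1
      (show Metric.infDist x (Y : Set X) < d + 1 / ((n : ℝ) + 1) from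
        lt_add_of_pos_right _ (by positivity))
    exact ⟨y, hy, by rwa [← dist_eq_norm]⟩
  choose u huY hu using hseq
  have hlim : Tendsto (fun n : ℕ => d + 1 / ((n : ℝ) + 1)) atTop (𝓝 d) := by
    simpa using (tendsto_const_nhds (x := d)).add
      (tendsto_one_div_add_atTop_nhds_zero_nat (𝕜 := ℝ))
  have hC : CauchySeq u := by
    rw [Metric.cauchySeq_iff]
    intro ε hε
    obtain ⟨η, hη, h⟩ := dist_lt_of_almost_nearest Y x d hd0 hmin hε
    obtain ⟨N, hN⟩ := eventually_atTop.1
      (hlim.eventually (gt_mem_nhds (show d < d + η by linarith)))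
    refine ⟨N, fun m hm n hn => ?_⟩
    rw [dist_eq_norm]
    exact h _ (huY m) _ (huY n) ((hu m).trans (hN m hm)).le ((hu n).trans (hN n hn)).le
  obtain ⟨y, hy⟩ := cauchySeq_tendsto_of_complete hC
  have hyY : y ∈ Y := hY.mem_of_tendsto hy (Eventually.of_forall huY)
  have hyd : ‖x - y‖ ≤ d :=
    le_of_tendsto_of_tendsto' (tendsto_const_nhds.sub hy).norm hlim fun n => (hu n).le
  refine ⟨y, ⟨hyY, fun y' hy' => hyd.trans (hmin y' hy')⟩, fun y' h' => ?_⟩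
  by_contra hyy
  have hpos : 0 < ‖y' - y‖ := norm_pos_iff.2 (sub_ne_zero.2 hyy)
  obtain ⟨η, hη, h⟩ := dist_lt_of_almost_nearest Y x d hd0 hmin hpos
  exact lt_irrefl _ (h y' h'.1 y hyY (by linarith [h'.2 y hyY]) (by linarith))

/-- The metric projection of `x` onto the closed subspace `Y`: the nearest point of `Y` to `x`. -/
noncomputable def metricProjection {X : Type*} [NormedAddCommGroup X] [NormedSpace ℂ X]
    [CompleteSpace X] [UniformConvexSpace X] (Y : Submodule ℂ X) (hY : IsClosed (Y : Set X))
    (x : X) : X :=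
  (existsUnique_isNearestPoint Y hY x).choose

theorem metricProjection_isNearestPoint {X : Type*} [NormedAddCommGroup X] [NormedSpace ℂ X]
    [CompleteSpace X] [UniformConvexSpace X] (Y : Submodule ℂ X) (hY : IsClosed (Y : Set X))
    (x : X) : IsNearestPoint Y x (metricProjection Y hY x) :=
  (existsUnique_isNearestPoint Y hY x).choose_spec.1

/-! ### Spaces of analytic functions -/

/-- The realization of a normed space `X` as a space of analytic functions on `Ω`: each vector `f`
is a function `fn f`, linearly in `f`, analytic on `Ω`, and determined by its values on `Ω`
(the values outside `Ω` are irrelevant). -/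
structure AnalyticFunctionSpace (Ω : Set ℂ) (X : Type*) [NormedAddCommGroup X]
    [NormedSpace ℂ X] where
  fn : X →ₗ[ℂ] (ℂ → ℂ)
  analytic : ∀ f : X, AnalyticOnNhd ℂ (fn f) Ω
  injective : ∀ f g : X, Set.EqOn (fn f) (fn g) Ω → f = g

namespace AnalyticFunctionSpace

/-- The four structural conditions on the function space. -/
structure Conditions {Ω : Set ℂ} {X : Type*} [NormedAddCommGroup X] [NormedSpace ℂ X]
    (A : AnalyticFunctionSpace Ω X) : Prop where
  /-- point evaluations of derivatives of every order are bounded -/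
  bounded_eval : ∀ (j : ℕ), ∀ w ∈ Ω, ∃ C : ℝ, ∀ f : X, ‖iteratedDeriv j (A.fn f) w‖ ≤ C * ‖f‖
  /-- `z f` belongs to the space -/
  mul_mem : ∀ f : X, ∃ g : X, ∀ z ∈ Ω, A.fn g z = z * A.fn f z
  /-- the monomials belong to the space -/
  monomial_mem : ∀ j : ℕ, ∃ p : X, ∀ z ∈ Ω, A.fn p z = z ^ j
  /-- the closed linear span of the monomials is the whole space -/
  dense : (Submodule.span ℂ {p : X | ∃ j : ℕ, ∀ z ∈ Ω, A.fn p z = z ^ j}).topologicalClosure = ⊤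
  /-- difference quotients belong to the space (the value at `w` is fixed by analyticity) -/
  quotient_mem : ∀ w ∈ Ω, ∀ f : X, ∃ g : X, ∀ z ∈ Ω, z ≠ w →
    A.fn g z = (A.fn f z - A.fn f w) / (z - w)

variable {Ω : Set ℂ} {X : Type*} [NormedAddCommGroup X] [NormedSpace ℂ X]

/-- The shift `f ↦ z f` as a linear map. -/
noncomputable def shiftLinear (A : AnalyticFunctionSpace Ω X) (h : A.Conditions) : X →ₗ[ℂ] X where
  toFun f := (h.mul_mem f).choose
  map_add' f g := A.injective _ _ fun z hz => by
    rw [(h.mul_mem (f + g)).choose_spec z hz, map_add, map_add, Pi.add_apply, Pi.add_apply,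
      (h.mul_mem f).choose_spec z hz, (h.mul_mem g).choose_spec z hz, mul_add]
  map_smul' c f := A.injective _ _ fun z hz => by
    rw [(h.mul_mem (c • f)).choose_spec z hz, RingHom.id_apply, map_smul, map_smul, Pi.smul_apply,
      Pi.smul_apply, (h.mul_mem f).choose_spec z hz, smul_eq_mul, smul_eq_mul, mul_left_comm]

theorem shiftLinear_apply (A : AnalyticFunctionSpace Ω X) (h : A.Conditions) (f : X) :
    ∀ z ∈ Ω, A.fn (A.shiftLinear h f) z = z * A.fn f z :=
  (h.mul_mem f).choose_spec

theorem tendsto_eval (A : AnalyticFunctionSpace Ω X) (h : A.Conditions) {w : ℂ} (hw : w ∈ Ω)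
    {u : ℕ → X} {f : X} (hu : Tendsto u atTop (𝓝 f)) :
    Tendsto (fun n => A.fn (u n) w) atTop (𝓝 (A.fn f w)) := by
  obtain ⟨C, hC⟩ := h.bounded_eval 0 w hw
  have e : Continuous ((LinearMap.proj w ∘ₗ A.fn : X →ₗ[ℂ] ℂ).mkContinuous C fun g => by
      simpa using hC g) := ContinuousLinearMap.continuous _
  exact (e.tendsto f).comp hu

/-- The shift operator `S f = z f` as a bounded operator (bounded by the closed graph theorem). -/
noncomputable def shift [CompleteSpace X] (A : AnalyticFunctionSpace Ω X) (h : A.Conditions) :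
    X →L[ℂ] X :=
  ⟨A.shiftLinear h, LinearMap.continuous_of_seq_closed_graph _ fun u x y hx hy => by
    refine A.injective _ _ fun z hz => ?_
    rw [A.shiftLinear_apply h x z hz]
    refine tendsto_nhds_unique (A.tendsto_eval h hz hy) ?_
    refine ((A.tendsto_eval h hz hx).const_mul z).congr fun n => ?_
    exact (A.shiftLinear_apply h (u n) z hz).symm⟩

theorem shift_apply [CompleteSpace X] (A : AnalyticFunctionSpace Ω X) (h : A.Conditions) (f : X) :
    ∀ z ∈ Ω, A.fn (A.shift h f) z = z * A.fn f z :=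
  A.shiftLinear_apply h f

theorem exists_zeroProduct (A : AnalyticFunctionSpace Ω X) (h : A.Conditions) (w : ℕ → ℂ)
    (n : ℕ) : ∃ f : X, ∀ z ∈ Ω, A.fn f z = ∏ j ∈ Finset.range n, (1 - z / w j) := by
  induction n with
  | zero => simpa using h.monomial_mem 0
  | succ n ih =>
    obtain ⟨f, hf⟩ := ih
    refine ⟨f - (w n)⁻¹ • A.shiftLinear h f, fun z hz => ?_⟩
    rw [map_sub, map_smul, Pi.sub_apply, Pi.smul_apply, A.shiftLinear_apply h f z hz, hf z hz,
      Finset.prod_range_succ, smul_eq_mul]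
    ring

/-- The polynomial `f_n(z) = ∏ (1 - z / w_j)` over the first `n` terms of `w`, as an element
of the space. -/
noncomputable def zeroProduct (A : AnalyticFunctionSpace Ω X) (h : A.Conditions) (w : ℕ → ℂ)
    (n : ℕ) : X :=
  (A.exists_zeroProduct h w n).choose

theorem zeroProduct_apply (A : AnalyticFunctionSpace Ω X) (h : A.Conditions) (w : ℕ → ℂ)
    (n : ℕ) : ∀ z ∈ Ω, A.fn (A.zeroProduct h w n) z = ∏ j ∈ Finset.range n, (1 - z / w j) :=
  (A.exists_zeroProduct h w n).choose_spec

/-- `J_n = f_n - P f_n`, with `P` the metric projection onto `[z f_n]`. -/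
noncomputable def innerJ [CompleteSpace X] [UniformConvexSpace X]
    (A : AnalyticFunctionSpace Ω X) (h : A.Conditions) (w : ℕ → ℂ) (n : ℕ) : X :=
  A.zeroProduct h w n -
    metricProjection (cyclicSubspace (A.shift h) (A.shift h (A.zeroProduct h w n)))
      (isClosed_cyclicSubspace _ _) (A.zeroProduct h w n)

/-- `w` is a zero sequence: some nonzero element of the space vanishes at every `w j`, to an order
at least the number of times (possibly infinite) that the value `w j` occurs in the sequence.
Further zeros are allowed. -/
def IsZeroSequence (A : AnalyticFunctionSpace Ω X) (w : ℕ → ℂ) : Prop :=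
  ∃ g : X, g ≠ 0 ∧ ∀ j k : ℕ, (k : ℕ∞) < {i : ℕ | w i = w j}.encard →
    iteratedDeriv k (A.fn g) (w j) = 0

end AnalyticFunctionSpace

/-! ### Cyclic subspaces and extremal vectors -/

section Cyclic

variable {X : Type*} [NormedAddCommGroup X] [NormedSpace ℂ X] {T : X →L[ℂ] X} {x y : X}

theorem pow_mem_cyclicSubspace (T : X →L[ℂ] X) (x : X) (n : ℕ) :
    (T ^ n) x ∈ cyclicSubspace T x :=
  Submodule.le_topologicalClosure _ (Submodule.subset_span ⟨n, rfl⟩)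

theorem self_mem_cyclicSubspace (T : X →L[ℂ] X) (x : X) : x ∈ cyclicSubspace T x :=
  pow_mem_cyclicSubspace T x 0

theorem cyclicSubspace_le {Y : Submodule ℂ X} (hY : IsClosed (Y : Set X))
    (h : ∀ n : ℕ, (T ^ n) x ∈ Y) : cyclicSubspace T x ≤ Y :=
  Submodule.topologicalClosure_minimal _
    (Submodule.span_le.2 (Set.range_subset_iff.2 h)) hY

theorem apply_mem_cyclicSubspace_apply (hy : y ∈ cyclicSubspace T x) :
    T y ∈ cyclicSubspace T (T x) := by
  have : cyclicSubspace T x ≤ (cyclicSubspace T (T x)).comap (T : X →ₗ[ℂ] X) := by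
    refine cyclicSubspace_le ((isClosed_cyclicSubspace T (T x)).preimage T.continuous) fun n => ?_
    have e : T ((T ^ n) x) = (T ^ n) (T x) := by
      rw [← mul_apply_eq_comp, ← mul_apply_eq_comp, ← pow_succ,
        ← pow_succ']
    change T ((T ^ n) x) ∈ cyclicSubspace T (T x)
    rw [e]
    exact pow_mem_cyclicSubspace T (T x) n
  exact this hy

theorem cyclicSubspace_apply_le (T : X →L[ℂ] X) (x : X) :
    cyclicSubspace T (T x) ≤ cyclicSubspace T x :=
  cyclicSubspace_le (isClosed_cyclicSubspace T x) fun n => by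
    rw [← mul_apply_eq_comp, ← pow_succ]
    exact pow_mem_cyclicSubspace T x (n + 1)

theorem apply_mem_cyclicSubspace (hy : y ∈ cyclicSubspace T x) : T y ∈ cyclicSubspace T x :=
  cyclicSubspace_apply_le T x (apply_mem_cyclicSubspace_apply hy)

theorem pow_apply_mem_cyclicSubspace (hy : y ∈ cyclicSubspace T x) (n : ℕ) :
    (T ^ n) y ∈ cyclicSubspace T x := by
  induction n with
  | zero => exact hy
  | succ n ih =>
    rw [pow_succ', mul_apply_eq_comp]
    exact apply_mem_cyclicSubspace ih

theorem cyclicSubspace_le_of_mem (hy : y ∈ cyclicSubspace T x) :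
    cyclicSubspace T y ≤ cyclicSubspace T x :=
  cyclicSubspace_le (isClosed_cyclicSubspace T x) (pow_apply_mem_cyclicSubspace hy)

/-- If `φ x = 1` and `φ` annihilates the range of `T`, then `φ` splits `[x]` as `ℂ x + [T x]`. -/
theorem sub_smul_mem_cyclicSubspace_apply {φ : X →L[ℂ] ℂ} (hx : φ x = 1) (hT : ∀ y, φ (T y) = 0)
    (hy : y ∈ cyclicSubspace T x) : y - φ y • x ∈ cyclicSubspace T (T x) := by
  let R : X →L[ℂ] X := ContinuousLinearMap.id ℂ X - φ.smulRight x
  have : cyclicSubspace T x ≤ (cyclicSubspace T (T x)).comap (R : X →ₗ[ℂ] X) := by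
    refine cyclicSubspace_le ((isClosed_cyclicSubspace T (T x)).preimage R.continuous) fun n => ?_
    change (T ^ n) x - φ ((T ^ n) x) • x ∈ cyclicSubspace T (T x)
    cases n with
    | zero => simp [hx]
    | succ n =>
      have e : φ ((T ^ (n + 1)) x) = 0 := by
        rw [pow_succ', mul_apply_eq_comp, hT]
      rw [e, zero_smul, sub_zero, pow_succ, mul_apply_eq_comp]
      exact pow_mem_cyclicSubspace T (T x) n
  exact this hy

theorem eq_zero_of_mem_cyclicSubspace_apply {φ : X →L[ℂ] ℂ} (hT : ∀ y, φ (T y) = 0)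
    (hy : y ∈ cyclicSubspace T (T x)) : φ y = 0 := by
  have : cyclicSubspace T (T x) ≤ (φ : X →ₗ[ℂ] ℂ).ker :=
    cyclicSubspace_le φ.isClosed_ker fun n => by
      change φ ((T ^ n) (T x)) = 0
      rw [← mul_apply_eq_comp, ← pow_succ, pow_succ', mul_apply_eq_comp, hT]
  exact this hy

variable [CompleteSpace X] [UniformConvexSpace X]

/-- The extremal vector `x - P x`, with `P` the metric projection onto `[T x]`. -/
noncomputable def extremalVector (T : X →L[ℂ] X) (x : X) : X :=
  x - metricProjection (cyclicSubspace T (T x)) (isClosed_cyclicSubspace _ _) x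

theorem extremalVector_sub_mem (T : X →L[ℂ] X) (x : X) :
    x - extremalVector T x ∈ cyclicSubspace T (T x) := by
  rw [extremalVector, sub_sub_cancel]
  exact (metricProjection_isNearestPoint _ _ x).1

theorem extremalVector_mem (T : X →L[ℂ] X) (x : X) :
    extremalVector T x ∈ cyclicSubspace T x := by
  have := (cyclicSubspace T x).sub_mem (self_mem_cyclicSubspace T x)
    (cyclicSubspace_apply_le T x (extremalVector_sub_mem T x))
  rwa [sub_sub_cancel] at this

theorem norm_extremalVector_le_add (hy : y ∈ cyclicSubspace T (T x)) :
    ‖extremalVector T x‖ ≤ ‖extremalVector T x + y‖ := by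
  have h := (metricProjection_isNearestPoint (cyclicSubspace T (T x))
    (isClosed_cyclicSubspace _ _) x).2 (x - extremalVector T x - y)
    (Submodule.sub_mem _ (extremalVector_sub_mem T x) hy)
  have e : x - (x - extremalVector T x - y) = extremalVector T x + y := by abel
  rwa [e] at h

theorem bjOrthogonal_extremalVector (hy : y ∈ cyclicSubspace T (T x)) :
    BJOrthogonal (extremalVector T x) y :=
  fun β => norm_extremalVector_le_add (Submodule.smul_mem _ β hy)

variable {φ : X →L[ℂ] ℂ}

theorem apply_extremalVector (hx : φ x = 1) (hT : ∀ y, φ (T y) = 0) :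
    φ (extremalVector T x) = 1 := by
  have := eq_zero_of_mem_cyclicSubspace_apply hT (extremalVector_sub_mem T x)
  rw [map_sub, hx, sub_eq_zero] at this
  exact this.symm

theorem isInnerVector_extremalVector (hx : φ x = 1) (hT : ∀ y, φ (T y) = 0) :
    IsInnerVector T (extremalVector T x) := by
  refine ⟨fun h => ?_, fun n hn => bjOrthogonal_extremalVector ?_⟩
  · have := apply_extremalVector hx hT
    rw [h, map_zero] at this
    exact zero_ne_one this
  · obtain ⟨m, rfl⟩ := Nat.exists_eq_add_of_le' hn
    rw [pow_succ', mul_apply_eq_comp]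
    exact apply_mem_cyclicSubspace_apply (pow_apply_mem_cyclicSubspace (extremalVector_mem T x) m)

theorem sub_extremalVector_mem (hx : φ x = 1) (hT : ∀ y, φ (T y) = 0)
    (hy : y ∈ cyclicSubspace T x) (hφ : φ y = 1) :
    y - extremalVector T x ∈ cyclicSubspace T (T x) := by
  have h := sub_smul_mem_cyclicSubspace_apply hx hT hy
  rw [hφ, one_smul] at h
  have e : y - extremalVector T x = (y - x) + (x - extremalVector T x) := by abel
  rw [e]
  exact Submodule.add_mem _ h (extremalVector_sub_mem T x)

/-- The extremal vector has the least norm among the `y ∈ [x]` with `φ y = 1`. -/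
theorem norm_extremalVector_le (hx : φ x = 1) (hT : ∀ y, φ (T y) = 0)
    (hy : y ∈ cyclicSubspace T x) (hφ : φ y = 1) : ‖extremalVector T x‖ ≤ ‖y‖ := by
  have h := norm_extremalVector_le_add (sub_extremalVector_mem hx hT hy hφ)
  rwa [add_sub_cancel] at h

end Cyclic

/-- In a space with a Pythagorean inequality, a norm-bounded sequence whose increments are
orthogonal to the earlier terms converges. -/
theorem cauchySeq_of_pythagorean {X : Type*} [NormedAddCommGroup X] [NormedSpace ℂ X]
    (hpyth : PythagoreanInequality X) {u : ℕ → X}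
    (hu : ∀ m n, m ≤ n → BJOrthogonal (u m) (u n - u m))
    (hb : BddAbove (Set.range fun n => ‖u n‖)) : CauchySeq u := by
  obtain ⟨r, K, hr, hK, H⟩ := hpyth
  have hinc : ∀ m n, m ≤ n → ‖u m‖ ^ r + K * ‖u n - u m‖ ^ r ≤ ‖u n‖ ^ r := fun m n hmn => by
    simpa using H _ _ (hu m n hmn)
  have hmono : Monotone fun n => ‖u n‖ ^ r := fun m n hmn => by
    have h1 := hinc m n hmn
    have h2 : 0 ≤ K * ‖u n - u m‖ ^ r := by positivity
    dsimp only
    linarith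
  have hbdd : BddAbove (Set.range fun n => ‖u n‖ ^ r) := by
    obtain ⟨M, hM⟩ := hb
    refine ⟨M ^ r, ?_⟩
    rintro _ ⟨n, rfl⟩
    exact Real.rpow_le_rpow (norm_nonneg _) (hM ⟨n, rfl⟩) hr.le
  have hC := (tendsto_atTop_ciSup hmono hbdd).cauchySeq
  rw [Metric.cauchySeq_iff'] at hC ⊢
  intro ε hε
  obtain ⟨N, hN⟩ := hC (K * ε ^ r) (by positivity)
  refine ⟨N, fun n hn => ?_⟩
  have h1 := hinc N n hn
  have h2 := (abs_lt.1 (Real.dist_eq _ _ ▸ hN n hn)).2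
  rw [dist_eq_norm]
  refine (Real.rpow_lt_rpow_iff (norm_nonneg _) hε.le hr).1 (lt_of_mul_lt_mul_left ?_ hK.le)
  linarith

/-! ### Multiplicities in a sequence and analytic orders -/

/-- The number of `i < n` with `w i = u`. -/
noncomputable def multiplicityBelow (w : ℕ → ℂ) (n : ℕ) (u : ℂ) : ℕ :=
  Set.ncard {i : ℕ | i < n ∧ w i = u}

theorem finite_setOf_lt_and (w : ℕ → ℂ) (n : ℕ) (u : ℂ) : {i : ℕ | i < n ∧ w i = u}.Finite :=
  (Set.finite_lt_nat n).subset fun _ hi => hi.1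

theorem cast_multiplicityBelow (w : ℕ → ℂ) (n : ℕ) (u : ℂ) :
    (multiplicityBelow w n u : ℕ∞) = {i : ℕ | i < n ∧ w i = u}.encard :=
  (finite_setOf_lt_and w n u).cast_ncard_eq

theorem multiplicityBelow_succ (w : ℕ → ℂ) (n : ℕ) (u : ℂ) :
    multiplicityBelow w (n + 1) u = multiplicityBelow w n u + if w n = u then 1 else 0 := by
  unfold multiplicityBelow
  split_ifs with h
  · have e : {i : ℕ | i < n + 1 ∧ w i = u} = insert n {i : ℕ | i < n ∧ w i = u} := by
      ext i
      simp only [Set.mem_ofPred_eq, Set.mem_insert_iff]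
      constructor
      · rintro ⟨h1, h2⟩
        rcases Nat.lt_succ_iff_lt_or_eq.1 h1 with h3 | h3
        exacts [Or.inr ⟨h3, h2⟩, Or.inl h3]
      · rintro (rfl | ⟨h1, h2⟩)
        exacts [⟨Nat.lt_succ_self _, h⟩, ⟨h1.trans (Nat.lt_succ_self n), h2⟩]
    rw [e, Set.ncard_insert_of_notMem (fun hn => lt_irrefl n hn.1) (finite_setOf_lt_and w n u)]
  · congr 1
    ext i
    constructor
    · rintro ⟨h1, h2⟩
      rcases Nat.lt_succ_iff_lt_or_eq.1 h1 with h3 | h3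
      exacts [⟨h3, h2⟩, absurd (h3 ▸ h2) h]
    · rintro ⟨h1, h2⟩
      exact ⟨h1.trans (Nat.lt_succ_self n), h2⟩

theorem multiplicityBelow_le_encard (w : ℕ → ℂ) (n : ℕ) (u : ℂ) :
    (multiplicityBelow w n u : ℕ∞) ≤ {i : ℕ | w i = u}.encard := by
  rw [cast_multiplicityBelow]
  exact Set.encard_le_encard fun i hi => hi.2

theorem exists_lt_multiplicityBelow {w : ℕ → ℂ} {u : ℂ} {k : ℕ}
    (hk : (k : ℕ∞) < {i : ℕ | w i = u}.encard) : ∃ n, k < multiplicityBelow w n u := by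
  have hk' : ((k + 1 : ℕ) : ℕ∞) ≤ {i : ℕ | w i = u}.encard := by
    push_cast
    exact Order.add_one_le_of_lt hk
  obtain ⟨s, hs, hc⟩ := Set.exists_subset_encard_eq hk'
  obtain ⟨N, hN⟩ := (Set.finite_of_encard_eq_coe hc).bddAbove
  refine ⟨N + 1, ?_⟩
  have h1 : s ⊆ {i : ℕ | i < N + 1 ∧ w i = u} := fun i hi =>
    ⟨Nat.lt_succ_of_le (hN hi), hs hi⟩
  have h2 := Set.encard_le_encard h1
  rw [hc, ← cast_multiplicityBelow] at h2
  exact_mod_cast h2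

theorem analyticOrderAt_one_sub_div {a : ℂ} (ha : a ≠ 0) (u : ℂ) :
    analyticOrderAt (fun z : ℂ => 1 - z / a) u = if a = u then 1 else 0 := by
  have han : AnalyticAt ℂ (fun z : ℂ => 1 - z / a) u := by fun_prop
  split_ifs with h
  · subst h
    refine han.analyticOrderAt_eq_one_of_zero_deriv_ne_zero (by simp [ha]) ?_
    have hd : HasDerivAt (fun z : ℂ => 1 - z / a) (-(1 / a)) a :=
      ((hasDerivAt_id a).div_const a).const_sub 1
    rw [hd.deriv]
    exact neg_ne_zero.2 (one_div_ne_zero ha)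
  · rw [han.analyticOrderAt_eq_zero]
    intro h0
    rw [sub_eq_zero, eq_comm, div_eq_one_iff_eq ha] at h0
    exact h h0.symm

theorem analyticAt_prod_one_sub_div (w : ℕ → ℂ) (n : ℕ) (u : ℂ) :
    AnalyticAt ℂ (fun z : ℂ => ∏ j ∈ Finset.range n, (1 - z / w j)) u := by
  fun_prop

theorem analyticOrderAt_prod_one_sub_div {w : ℕ → ℂ} (hw : ∀ j, w j ≠ 0) (n : ℕ) (u : ℂ) :
    analyticOrderAt (fun z : ℂ => ∏ j ∈ Finset.range n, (1 - z / w j)) u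
      = multiplicityBelow w n u := by
  induction n with
  | zero =>
    have : AnalyticAt ℂ (fun _ : ℂ => (1 : ℂ)) u := analyticAt_const
    simpa [multiplicityBelow] using this.analyticOrderAt_eq_zero.2 one_ne_zero
  | succ n ih =>
    have e : (fun z : ℂ => ∏ j ∈ Finset.range (n + 1), (1 - z / w j))
        = (fun z : ℂ => ∏ j ∈ Finset.range n, (1 - z / w j)) * fun z : ℂ => 1 - z / w n := by
      ext z
      rw [Finset.prod_range_succ, Pi.mul_apply]
    rw [e, analyticOrderAt_mul (analyticAt_prod_one_sub_div w n u) (by fun_prop), ih,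
      analyticOrderAt_one_sub_div (hw n), multiplicityBelow_succ]
    split_ifs <;> simp

namespace AnalyticFunctionSpace

variable {Ω : Set ℂ} {X : Type*} [NormedAddCommGroup X] [NormedSpace ℂ X]

/-- The functional `f ↦ f⁽ᵏ⁾(u)`. -/
noncomputable def derivEval (A : AnalyticFunctionSpace Ω X) (h : A.Conditions) (k : ℕ) {u : ℂ}
    (hu : u ∈ Ω) : X →L[ℂ] ℂ :=
  LinearMap.mkContinuous
    { toFun := fun f => iteratedDeriv k (A.fn f) u
      map_add' := fun f g => by
        rw [map_add, iteratedDeriv_add (A.analytic f u hu).contDiffAt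
          (A.analytic g u hu).contDiffAt]
      map_smul' := fun c f => by
        rw [map_smul, iteratedDeriv_const_smul_field, RingHom.id_apply] }
    (h.bounded_eval k u hu).choose (h.bounded_eval k u hu).choose_spec

theorem derivEval_apply (A : AnalyticFunctionSpace Ω X) (h : A.Conditions) (k : ℕ) {u : ℂ}
    (hu : u ∈ Ω) (f : X) : A.derivEval h k hu f = iteratedDeriv k (A.fn f) u :=
  rfl

theorem derivEval_zero_apply (A : AnalyticFunctionSpace Ω X) (h : A.Conditions) {u : ℂ}
    (hu : u ∈ Ω) (f : X) : A.derivEval h 0 hu f = A.fn f u := by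
  rw [derivEval_apply, iteratedDeriv_zero]

theorem isZeroSequence_iff (A : AnalyticFunctionSpace Ω X) {w : ℕ → ℂ} (hw : ∀ j, w j ∈ Ω) :
    A.IsZeroSequence w ↔
      ∃ g : X, g ≠ 0 ∧ ∀ n j, (multiplicityBelow w n (w j) : ℕ∞) ≤ analyticOrderAt (A.fn g) (w j) := by
  refine exists_congr fun g => and_congr_right fun _ => ⟨fun H n j => ?_, fun H j k hk => ?_⟩
  · rw [natCast_le_analyticOrderAt_iff_iteratedDeriv_eq_zero (A.analytic g _ (hw j))]
    exact fun i hi => H j i ((Nat.cast_lt.2 hi).trans_le (multiplicityBelow_le_encard w n (w j)))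
  · obtain ⟨n, hn⟩ := exists_lt_multiplicityBelow hk
    exact (natCast_le_analyticOrderAt_iff_iteratedDeriv_eq_zero (A.analytic g _ (hw j))).1
      (H n j) k hn

theorem analyticOrderAt_mul_of_eqOn (A : AnalyticFunctionSpace Ω X) (hΩ : IsOpen Ω) {f q : X}
    {p : ℂ → ℂ} {u : ℂ} (hu : u ∈ Ω) (hp : AnalyticAt ℂ p u)
    (h : ∀ z ∈ Ω, A.fn f z = p z * A.fn q z) :
    analyticOrderAt (A.fn f) u = analyticOrderAt p u + analyticOrderAt (A.fn q) u := by
  rw [← analyticOrderAt_mul hp (A.analytic q u hu)]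
  exact analyticOrderAt_congr (eventually_of_mem (hΩ.mem_nhds hu) h)

/-- A zero can be divided out within the space. -/
theorem exists_sub_mul_eq (A : AnalyticFunctionSpace Ω X) (h : A.Conditions) {f : X} {a : ℂ}
    (ha : a ∈ Ω) (hf : A.fn f a = 0) : ∃ q : X, ∀ z ∈ Ω, A.fn f z = (z - a) * A.fn q z := by
  obtain ⟨q, hq⟩ := h.quotient_mem a ha f
  refine ⟨q, fun z hz => ?_⟩
  by_cases hza : z = a
  · rw [hza, hf, sub_self, zero_mul]
  · rw [hq z hz hza, hf, sub_zero, mul_div_cancel₀ _ (sub_ne_zero.2 hza)]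

theorem exists_one_sub_div_mul_eq (A : AnalyticFunctionSpace Ω X) (h : A.Conditions) {f : X}
    {a : ℂ} (ha : a ∈ Ω) (ha0 : a ≠ 0) (hf : A.fn f a = 0) :
    ∃ q : X, ∀ z ∈ Ω, A.fn f z = (1 - z / a) * A.fn q z := by
  obtain ⟨q, hq⟩ := A.exists_sub_mul_eq h ha hf
  refine ⟨-a • q, fun z hz => ?_⟩
  rw [hq z hz, map_smul, Pi.smul_apply, smul_eq_mul]
  field_simp
  ring

theorem analyticOrderAt_ne_top (A : AnalyticFunctionSpace Ω X) (hΩ : IsPreconnected Ω) {f : X}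
    (hf : f ≠ 0) {u : ℂ} (hu : u ∈ Ω) : analyticOrderAt (A.fn f) u ≠ ⊤ := by
  intro htop
  refine hf (A.injective f 0 fun z hz => ?_)
  rw [(A.analytic f).eqOn_zero_of_preconnected_of_eventuallyEq_zero hΩ hu
    (analyticOrderAt_eq_top.1 htop) hz, map_zero]

/-- The zero at the origin can be divided out completely. -/
theorem exists_pow_mul_eq (A : AnalyticFunctionSpace Ω X) (h : A.Conditions) (hΩo : IsOpen Ω)
    (h0 : (0 : ℂ) ∈ Ω) {f : X} (hf : analyticOrderAt (A.fn f) 0 ≠ ⊤) :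
    ∃ (m : ℕ) (q : X), A.fn q 0 ≠ 0 ∧ ∀ z ∈ Ω, A.fn f z = z ^ m * A.fn q z := by
  obtain ⟨m, hm⟩ := ENat.ne_top_iff_exists.1 hf
  refine ⟨m, ?_⟩
  clear hf
  induction m generalizing f with
  | zero =>
    refine ⟨f, (A.analytic f 0 h0).analyticOrderAt_eq_zero.1 (by simpa using hm.symm), ?_⟩
    simp
  | succ m ih =>
    have hf0 : A.fn f 0 = 0 := apply_eq_zero_of_analyticOrderAt_ne_zero (by rw [← hm]; simp)
    obtain ⟨g, hg⟩ := A.exists_sub_mul_eq h h0 hf0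
    have ho := A.analyticOrderAt_mul_of_eqOn hΩo h0 (by fun_prop) hg
    rw [analyticOrderAt_id_sub_const_self, ← hm, Nat.cast_add, Nat.cast_one, add_comm] at ho
    obtain ⟨q, hq0, hq⟩ := ih ((ENat.add_right_injective_of_ne_top ENat.one_ne_top) ho)
    refine ⟨q, hq0, fun z hz => ?_⟩
    rw [hg z hz, hq z hz, sub_zero, pow_succ']
    ring

/-- An element whose zeros include the first `n` terms of `w` is divisible by `f_n`. -/
theorem exists_prod_mul_eq (A : AnalyticFunctionSpace Ω X) (h : A.Conditions) (hΩo : IsOpen Ω)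
    {w : ℕ → ℂ} (hw : ∀ j, w j ∈ Ω \ {0}) {g : X}
    (hg : ∀ n j, (multiplicityBelow w n (w j) : ℕ∞) ≤ analyticOrderAt (A.fn g) (w j)) (n : ℕ) :
    ∃ q : X, ∀ z ∈ Ω, A.fn g z = (∏ j ∈ Finset.range n, (1 - z / w j)) * A.fn q z := by
  induction n with
  | zero => exact ⟨g, by simp⟩
  | succ n ih =>
    obtain ⟨q, hq⟩ := ih
    have ho := A.analyticOrderAt_mul_of_eqOn hΩo (hw n).1 (analyticAt_prod_one_sub_div w n _) hq
    have hn := hg (n + 1) n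
    rw [ho, analyticOrderAt_prod_one_sub_div (fun j => (hw j).2), multiplicityBelow_succ,
      if_pos rfl, Nat.cast_add, ENat.add_le_add_iff_left (ENat.natCast_ne_top _)] at hn
    have hq0 : A.fn q (w n) = 0 := by
      refine apply_eq_zero_of_analyticOrderAt_ne_zero fun h0 => ?_
      rw [h0] at hn
      simp at hn
    obtain ⟨q', hq'⟩ := A.exists_one_sub_div_mul_eq h (hw n).1 (hw n).2 hq0
    refine ⟨q', fun z hz => ?_⟩
    rw [hq z hz, hq' z hz, Finset.prod_range_succ, mul_assoc]

variable [CompleteSpace X]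

theorem shift_pow_apply (A : AnalyticFunctionSpace Ω X) (h : A.Conditions) (k : ℕ) (f : X) :
    ∀ z ∈ Ω, A.fn ((A.shift h ^ k) f) z = z ^ k * A.fn f z := by
  induction k with
  | zero => simp
  | succ k ih =>
    intro z hz
    rw [pow_succ', mul_apply_eq_comp, A.shift_apply h _ z hz, ih z hz, pow_succ', mul_assoc]

theorem zeroProduct_succ (A : AnalyticFunctionSpace Ω X) (h : A.Conditions) (w : ℕ → ℂ) (n : ℕ) :
    A.zeroProduct h w (n + 1)
      = A.zeroProduct h w n - (w n)⁻¹ • A.shift h (A.zeroProduct h w n) := by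
  refine A.injective _ _ fun z hz => ?_
  rw [map_sub, map_smul, Pi.sub_apply, Pi.smul_apply, A.shift_apply h _ z hz,
    A.zeroProduct_apply h w _ z hz, A.zeroProduct_apply h w _ z hz, Finset.prod_range_succ,
    smul_eq_mul]
  ring

theorem antitone_cyclicSubspace_zeroProduct (A : AnalyticFunctionSpace Ω X) (h : A.Conditions)
    (w : ℕ → ℂ) : Antitone fun n => cyclicSubspace (A.shift h) (A.zeroProduct h w n) := by
  refine antitone_nat_of_succ_le fun n => cyclicSubspace_le_of_mem ?_
  have hm := self_mem_cyclicSubspace (A.shift h) (A.zeroProduct h w n)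
  rw [zeroProduct_succ]
  exact Submodule.sub_mem _ hm (Submodule.smul_mem _ _ (apply_mem_cyclicSubspace hm))

/-- Multiplication by `f_n` is a bounded operator. -/
theorem exists_mulZeroProduct (A : AnalyticFunctionSpace Ω X) (h : A.Conditions) (w : ℕ → ℂ)
    (n : ℕ) : ∃ M : X →L[ℂ] X, ∀ q, ∀ z ∈ Ω,
      A.fn (M q) z = (∏ j ∈ Finset.range n, (1 - z / w j)) * A.fn q z := by
  induction n with
  | zero => exact ⟨ContinuousLinearMap.id ℂ X, by simp⟩
  | succ n ih =>
    obtain ⟨M, hM⟩ := ih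
    refine ⟨M - (w n)⁻¹ • (A.shift h ∘L M), fun q z hz => ?_⟩
    change A.fn (M q - (w n)⁻¹ • A.shift h (M q)) z = _
    rw [map_sub, map_smul, Pi.sub_apply, Pi.smul_apply, A.shift_apply h _ z hz, hM q z hz,
      Finset.prod_range_succ, smul_eq_mul]
    ring

theorem mem_cyclicSubspace_zeroProduct (A : AnalyticFunctionSpace Ω X) (h : A.Conditions)
    (w : ℕ → ℂ) (n : ℕ) {g q : X}
    (hq : ∀ z ∈ Ω, A.fn g z = (∏ j ∈ Finset.range n, (1 - z / w j)) * A.fn q z) :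
    g ∈ cyclicSubspace (A.shift h) (A.zeroProduct h w n) := by
  obtain ⟨M, hM⟩ := A.exists_mulZeroProduct h w n
  have hgM : g = M q := A.injective _ _ fun z hz => by rw [hq z hz, hM q z hz]
  set Y := (cyclicSubspace (A.shift h) (A.zeroProduct h w n)).comap (M : X →ₗ[ℂ] X) with hY
  have hle : (⊤ : Submodule ℂ X) ≤ Y := by
    rw [← h.dense]
    refine Submodule.topologicalClosure_minimal _ (Submodule.span_le.2 ?_)
      ((isClosed_cyclicSubspace _ _).preimage M.continuous)
    rintro p ⟨j, hp⟩
    have e : M p = (A.shift h ^ j) (A.zeroProduct h w n) := A.injective _ _ fun z hz => by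
      rw [hM p z hz, hp z hz, A.shift_pow_apply h j _ z hz, A.zeroProduct_apply h w n z hz,
        mul_comm]
    change M p ∈ cyclicSubspace (A.shift h) (A.zeroProduct h w n)
    rw [e]
    exact pow_mem_cyclicSubspace _ _ j
  rw [hgM]
  exact hle (Submodule.mem_top (x := q))

theorem multiplicityBelow_le_analyticOrderAt (A : AnalyticFunctionSpace Ω X) (h : A.Conditions)
    (hΩo : IsOpen Ω) {w : ℕ → ℂ} (hw : ∀ j, w j ≠ 0) {n : ℕ} {g : X}
    (hg : g ∈ cyclicSubspace (A.shift h) (A.zeroProduct h w n)) {u : ℂ} (hu : u ∈ Ω) :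
    (multiplicityBelow w n u : ℕ∞) ≤ analyticOrderAt (A.fn g) u := by
  rw [natCast_le_analyticOrderAt_iff_iteratedDeriv_eq_zero (A.analytic g u hu)]
  intro k hk
  have hle : cyclicSubspace (A.shift h) (A.zeroProduct h w n)
      ≤ (A.derivEval h k hu : X →ₗ[ℂ] ℂ).ker := by
    refine cyclicSubspace_le (A.derivEval h k hu).isClosed_ker fun j => ?_
    change iteratedDeriv k (A.fn ((A.shift h ^ j) (A.zeroProduct h w n))) u = 0
    refine (natCast_le_analyticOrderAt_iff_iteratedDeriv_eq_zero (A.analytic _ u hu)).1 ?_ k hk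
    rw [A.analyticOrderAt_mul_of_eqOn hΩo hu (by fun_prop) (A.shift_pow_apply h j _),
      analyticOrderAt_congr (eventually_of_mem (hΩo.mem_nhds hu) (A.zeroProduct_apply h w n)),
      analyticOrderAt_prod_one_sub_div hw]
    exact le_add_self
  exact hle hg

end AnalyticFunctionSpace

theorem mainTheorem2 {X : Type*} [NormedAddCommGroup X] [NormedSpace ℂ X] [CompleteSpace X]
    [UniformConvexSpace X] (hsmooth : IsSmoothSpace X)
    (Ω : Set ℂ) (hΩo : IsOpen Ω) (hΩc : IsConnected Ω) (h0 : (0 : ℂ) ∈ Ω)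
    (A : AnalyticFunctionSpace Ω X) (hA : A.Conditions) (hpyth : PythagoreanInequality X)
    (w : ℕ → ℂ) (hw : ∀ j, w j ∈ Ω \ {0}) :
    (∀ n, IsInnerVector (A.shift hA) (A.innerJ hA w n)) ∧
    (Monotone fun n => ‖A.innerJ hA w n‖) ∧
    (A.IsZeroSequence w ↔ BddAbove (Set.range fun n => ‖A.innerJ hA w n‖)) := by
  have hJ : ∀ n, A.innerJ hA w n = extremalVector (A.shift hA) (A.zeroProduct hA w n) :=
    fun n => rfl
  simp only [hJ]
  set S := A.shift hA
  set f := A.zeroProduct hA w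
  set φ := A.derivEval hA 0 h0 with hφ
  have hφf : ∀ n, φ (f n) = 1 := fun n => by
    rw [hφ, A.derivEval_zero_apply, A.zeroProduct_apply hA w n 0 h0]
    simp
  have hφS : ∀ y, φ (S y) = 0 := fun y => by
    rw [hφ, A.derivEval_zero_apply, A.shift_apply hA y 0 h0, zero_mul]
  have hanti : Antitone fun n => cyclicSubspace S (f n) :=
    A.antitone_cyclicSubspace_zeroProduct hA w
  have hJφ : ∀ n, φ (extremalVector S (f n)) = 1 := fun n => apply_extremalVector (hφf n) hφS
  have hJm : ∀ m n, m ≤ n → extremalVector S (f n) ∈ cyclicSubspace S (f m) := fun m n hmn =>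
    hanti hmn (extremalVector_mem S (f n))
  refine ⟨fun n => isInnerVector_extremalVector (hφf n) hφS, fun m n hmn =>
    norm_extremalVector_le (hφf m) hφS (hJm m n hmn) (hJφ n), ?_⟩
  rw [A.isZeroSequence_iff fun j => (hw j).1]
  constructor
  · rintro ⟨g, hg0, hg⟩
    obtain ⟨m, q, hq0, hq⟩ := A.exists_pow_mul_eq hA hΩo h0
      (A.analyticOrderAt_ne_top hΩc.isPreconnected hg0 h0)
    have hqw : ∀ n j, (multiplicityBelow w n (w j) : ℕ∞) ≤ analyticOrderAt (A.fn q) (w j) := by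
      intro n j
      have hp : AnalyticAt ℂ (fun z : ℂ => z ^ m) (w j) := by fun_prop
      have := hg n j
      rwa [A.analyticOrderAt_mul_of_eqOn hΩo (hw j).1 hp hq,
        hp.analyticOrderAt_eq_zero.2 (pow_ne_zero m (hw j).2), zero_add] at this
    refine ⟨‖(A.fn q 0)⁻¹ • q‖, ?_⟩
    rintro _ ⟨n, rfl⟩
    obtain ⟨q', hq'⟩ := A.exists_prod_mul_eq hA hΩo hw hqw n
    refine norm_extremalVector_le (hφf n) hφS
      (Submodule.smul_mem _ _ (A.mem_cyclicSubspace_zeroProduct hA w n hq')) ?_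
    rw [map_smul, hφ, A.derivEval_zero_apply, smul_eq_mul, inv_mul_cancel₀ hq0]
  · intro hb
    have hC : CauchySeq fun n => extremalVector S (f n) :=
      cauchySeq_of_pythagorean hpyth (fun m n hmn => bjOrthogonal_extremalVector
        (sub_extremalVector_mem (hφf m) hφS (hJm m n hmn) (hJφ n))) hb
    obtain ⟨g, hg⟩ := cauchySeq_tendsto_of_complete hC
    have hg1 : φ g = 1 :=
      tendsto_nhds_unique ((φ.continuous.tendsto g).comp hg)
        (tendsto_const_nhds.congr fun n => (hJφ n).symm)
    refine ⟨g, fun h => ?_, fun n j => ?_⟩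
    · rw [h, map_zero] at hg1
      exact zero_ne_one hg1
    · exact A.multiplicityBelow_le_analyticOrderAt hA hΩo (fun i => (hw i).2)
        ((isClosed_cyclicSubspace S (f n)).mem_of_tendsto hg
          (eventually_atTop.2 ⟨n, fun k hk => hJm n k hk⟩)) (hw j).1
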